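/- Let $G=(V,E)$ be a finite simple graph with vertex set $V=\{1,\dots,k\}$ and let $u=(u_1,\dots,u_k)$ be a $k$-tuple of positive integers. Positive integers $a_1,\dots,a_k$ are called $G$-wise relatively prime if $\gcd(a_i,a_j)=1$ whenever $\{i,j\}\in E$. Let $Q_G^{(u)}(n)$ be the number of $k$-tuples $(a_1,\dots,a_k)$ of integers with $1\le a_1,\dots,a_k\le n$ that are $G$-wise relatively prime and satisfy $\gcd(a_i,u_i)=1$ for $i=1,\dots,k$. Let $i_m(G)$ be the number of independent sets of cardinality $m$ in $G$; for $S\subseteq V$ let $i_{m,S}(G)$ be the number of independent sets of cardinality $m$ in $G$ that contain at least one vertex of $S$; and let $S(u,p)=\{i\in V: p\mid u_i\}$. Put $$A_G=\prod_{p}\left(\sum_{m=0}^{k} i_m(G)\left(1-\frac1p\right)^{k-m}\frac1{p^m}\right),$$ where $p$ runs over all primes, and $$f_G(u)=\prod_{p\mid u_1u_2\cdots u_k}\left(1-\frac{\sum_{m=0}^{k} i_{m,S(u,p)}(G)\,(p-1)^{k-m}}{\sum_{m=0}^{k} i_m(G)\,(p-1)^{k-m}}\right),$$ where $p$ runs over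 the primes dividing $u_1u_2\cdots u_k$. Then the infinite product defining $A_G$ converges (unconditionally), and $$\lim_{n\to\infty}\frac{Q_G^{(u)}(n)}{n^k}=A_G\,f_G(u);$$ that is, the density (the limit as $n\to\infty$ of the proportion in $\{1,\dots,n\}^k$) of the $k$-tuples of positive integers that are $G$-wise relatively prime and satisfy $\gcd(a_i,u_i)=1$ for all $i$ is $A_Gf_G(u)$. In particular, taking all $u_i=1$, the probability (in the sense of this density) that $k$ positive integers are $G$-wise relatively prime is $A_G$. -/

import Mathlib

open Filter Topology

noncomputable section

namespace GwisePrimality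

/-- The integers `a i` are `G`-wise relatively prime: adjacent indices carry coprime integers. -/
def GwiseCoprime {k : ℕ} (G : SimpleGraph (Fin k)) (a : Fin k → ℕ) : Prop :=
  ∀ i j : Fin k, G.Adj i j → Nat.Coprime (a i) (a j)

/-- The box of `k`-tuples of positive integers `a` with `1 ≤ a i ≤ n` for all `i`. -/
def box (k n : ℕ) : Finset (Fin k → ℕ) :=
  Fintype.piFinset fun _ => Finset.Icc 1 n

open Classical in
/-- The number `Q_G^{(u)}(n)` of `k`-tuples of positive integers `a i ≤ n` that are `G`-wise
relatively prime and satisfy `(a i, u i) = 1` for all `i`. -/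
def Q {k : ℕ} (G : SimpleGraph (Fin k)) (u : Fin k → ℕ) (n : ℕ) : ℕ :=
  ((box k n).filter fun a => (∀ i, Nat.Coprime (a i) (u i)) ∧ GwiseCoprime G a).card

open Classical in
/-- The set `P` of `k`-tuples of positive integers has density (probability) `δ`: the proportion of
tuples in `{1, …, n}^k` that belong to `P` tends to `δ` as `n → ∞`. -/
def HasDensity {k : ℕ} (P : Set (Fin k → ℕ)) (δ : ℝ) : Prop :=
  Tendsto (fun n : ℕ => (((box k n).filter fun a => a ∈ P).card : ℝ) / (n : ℝ) ^ k)
    atTop (𝓝 δ)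

open Classical in
/-- `i_m(G)`: the number of independent sets of cardinality `m` in `G`. -/
def indepCount {k : ℕ} (G : SimpleGraph (Fin k)) (m : ℕ) : ℕ :=
  ((Finset.univ.powersetCard m).filter fun T : Finset (Fin k) =>
    G.IsIndepSet (T : Set (Fin k))).card

open Classical in
/-- `i_{m,S}(G)`: the number of independent sets of cardinality `m` in `G` that contain at least
one vertex of `S`. -/
def indepCountMeeting {k : ℕ} (G : SimpleGraph (Fin k)) (S : Finset (Fin k)) (m : ℕ) : ℕ :=
  ((Finset.univ.powersetCard m).filter fun T : Finset (Fin k) =>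
    G.IsIndepSet (T : Set (Fin k)) ∧ ∃ v ∈ T, v ∈ S).card

/-- `S(u,d)`: the set of indices `i` with `d ∣ u i`. -/
def dividingIndices {k : ℕ} (u : Fin k → ℕ) (d : ℕ) : Finset (Fin k) :=
  Finset.univ.filter fun i => d ∣ u i

/-- The factor at `p` of the Euler product `A_G`. -/
def eulerFactor {k : ℕ} (G : SimpleGraph (Fin k)) (p : ℕ) : ℝ :=
  ∑ m ∈ Finset.range (k + 1),
    (indepCount G m : ℝ) * (1 - 1 / (p : ℝ)) ^ (k - m) * (1 / (p : ℝ) ^ m)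

/-- The Euler product `A_G`, over all primes. -/
def A {k : ℕ} (G : SimpleGraph (Fin k)) : ℝ :=
  ∏' p : Nat.Primes, eulerFactor G (p : ℕ)

/-- `f_G(u)`, a finite product over the primes dividing `u_1 u_2 ⋯ u_k`. -/
def f {k : ℕ} (G : SimpleGraph (Fin k)) (u : Fin k → ℕ) : ℝ :=
  ∏ p ∈ (∏ i, u i).primeFactors,
    (1 - (∑ m ∈ Finset.range (k + 1),
            (indepCountMeeting G (dividingIndices u p) m : ℝ) * ((p : ℝ) - 1) ^ (k - m)) /
          (∑ m ∈ Finset.range (k + 1), (indepCount G m : ℝ) * ((p : ℝ) - 1) ^ (k - m)))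

end GwisePrimality

end

/-! The condition on a tuple is local: it holds iff, for every prime `p`, the set T of indices `i`
with `p ∣ a i` is independent in `G` and disjoint from S(u,p) (`coprime_and_gwiseCoprime_iff`). For
finitely many primes these sets behave like independent random sets, each index lying in T with
probability 1/p, so the sieved density is a finite product of local sums
(`tendsto_card_dividingIndices_mem_div`). Each local sum is the factor of `A G` at `p` times the
factor of `f G u` (`sum_indepSetsAvoiding_patternWeight`).

To reach all primes, let `P` contain every prime dividing some `u i`. A tuple that passes the sieve
by `P` but fails globally has a prime outside `P` dividing two adjacent coordinates. Such tuples
have proportion at most k² ∑_{p ∉ P} 1/p², uniformly in `n` (`abs_Q_div_sub_card_div_le`), so the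
limits in `n` and `P` may be interchanged. -/

namespace GwisePrimality

/-! ### Densities under finitely many divisibility conditions -/

section Sieve

theorem tendsto_sum_dvd_div (d : ℕ) :
    Tendsto (fun n : ℕ => (∑ b ∈ Finset.Icc 1 n, if d ∣ b then (1 : ℝ) else 0) / n) atTop
      (𝓝 (1 / d)) := by
  have h := (tendsto_nat_floor_mul_div_atTop (R := ℝ) (a := 1 / d) (by positivity)).comp
    tendsto_natCast_atTop_atTop
  refine h.congr fun n => ?_
  have h1 : (1 / (d : ℝ)) * n = (n : ℝ) / d := by ring
  rw [Function.comp_apply, h1, Nat.floor_div_natCast, Nat.floor_natCast, Finset.sum_boole,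
    ← Nat.Ioc_filter_dvd_card_eq_div]
  rfl

open Classical in
/-- The density of the multiples of `d` whose divisibility by each `p ∈ P` is prescribed by
membership of `p` in `D`. -/
theorem tendsto_sum_dvd_pattern_div (D : Set Nat.Primes) (P : Finset Nat.Primes) :
    ∀ d : ℕ, (∀ p ∈ P, Nat.Coprime d p) →
    Tendsto (fun n : ℕ => (∑ b ∈ Finset.Icc 1 n, (if d ∣ b then (1 : ℝ) else 0) *
        ∏ p ∈ P, if p ∈ D ↔ (p : ℕ) ∣ b then (1 : ℝ) else 0) / n) atTop
      (𝓝 (1 / d * ∏ p ∈ P, if p ∈ D then 1 / (p : ℝ) else 1 - 1 / (p : ℝ))) := by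
  induction P using Finset.induction_on with
  | empty => intro d _; simpa using tendsto_sum_dvd_div d
  | insert q P hq ih =>
    intro d hd
    have hdq : Nat.Coprime d q := hd q (Finset.mem_insert_self _ _)
    have h1 := ih d fun p hp => hd p (Finset.mem_insert_of_mem hp)
    have h2 := ih (d * q) fun p hp => Nat.Coprime.mul_left
      (hd p (Finset.mem_insert_of_mem hp))
      ((Nat.coprime_primes q.2 p.2).2 fun h => hq (by rwa [Subtype.ext h]))
    have hmul (b : ℕ) : (if d * q ∣ b then (1 : ℝ) else 0)
        = (if d ∣ b then 1 else 0) * if (q : ℕ) ∣ b then 1 else 0 := by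
      have : d * q ∣ b ↔ d ∣ b ∧ (q : ℕ) ∣ b :=
        ⟨fun h => ⟨dvd_of_mul_right_dvd h, dvd_of_mul_left_dvd h⟩,
          fun h => hdq.mul_dvd_of_dvd_of_dvd h.1 h.2⟩
      simp only [this, ite_and]
      split_ifs <;> simp
    -- A required divisibility by `q` is absorbed into `d`; a forbidden one is the difference of the
    -- cases `d` and `d * q`. This is why the induction quantifies over `d`.
    by_cases hqD : q ∈ D
    · convert h2 using 2
      · congr 1
        refine Finset.sum_congr rfl fun b _ => ?_
        rw [Finset.prod_insert hq, hmul, mul_assoc]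
        simp [hqD]
      · rw [Finset.prod_insert hq, if_pos hqD]
        push_cast
        ring
    · convert h1.sub h2 using 2
      · rw [← sub_div, ← Finset.sum_sub_distrib]
        congr 1
        refine Finset.sum_congr rfl fun b _ => ?_
        rw [Finset.prod_insert hq, hmul]
        simp only [hqD, false_iff]
        split_ifs <;> simp
      · rw [Finset.prod_insert hq, if_neg hqD]
        push_cast
        ring

/-- The probability that, of `k` independent residues modulo `p`, exactly those with index in `T`
vanish. -/
noncomputable def patternWeight {k : ℕ} (p : ℕ) (T : Finset (Fin k)) : ℝ :=
  ∏ i, if i ∈ T then 1 / (p : ℝ) else 1 - 1 / (p : ℝ)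

open Classical in
/-- The density of the tuples whose sets of indices of coordinates divisible by `p` are constrained
to lie in `W p`, for `p` in a finite set of primes. -/
theorem tendsto_card_dividingIndices_mem_div {k : ℕ} (P : Finset Nat.Primes)
    (W : Nat.Primes → Finset (Finset (Fin k))) :
    Tendsto (fun n : ℕ => (((box k n).filter fun a =>
        ∀ p ∈ P, dividingIndices a p ∈ W p).card : ℝ) / (n : ℝ) ^ k) atTop
      (𝓝 (∏ p ∈ P, ∑ T ∈ W p, patternWeight p T)) := by
  -- Expanding the product over one choice `x p ∈ W p` per prime and swapping products separates the
  -- coordinates.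
  have hlim : ∏ p ∈ P, ∑ T ∈ W p, patternWeight p T
      = ∑ x ∈ Fintype.piFinset fun p : P => W p, ∏ i, ∏ p : P,
          if i ∈ x p then 1 / ((p : ℕ) : ℝ) else 1 - 1 / ((p : ℕ) : ℝ) := by
    rw [← Finset.prod_coe_sort, Finset.prod_univ_sum]
    exact Finset.sum_congr rfl fun x _ => Finset.prod_comm
  have hind (a : Fin k → ℕ) : (if ∀ p ∈ P, dividingIndices a p ∈ W p then (1 : ℝ) else 0)
      = ∑ x ∈ Fintype.piFinset fun p : P => W p, ∏ i, ∏ p : P,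
          if i ∈ x p ↔ (p : ℕ) ∣ a i then (1 : ℝ) else 0 := by
    have h1 (T : Finset (Fin k)) (p : ℕ) :
        (∏ i, if i ∈ T ↔ p ∣ a i then (1 : ℝ) else 0) = if dividingIndices a p = T then 1 else 0 := by
      rw [Finset.prod_boole]
      congr 1
      simp [Finset.ext_iff, dividingIndices, iff_comm]
    rw [← Finset.prod_boole, ← Finset.prod_coe_sort]
    simp_rw [fun x : P → Finset (Fin k) => Finset.prod_comm (s := (Finset.univ : Finset (Fin k)))
      (t := (Finset.univ : Finset P)) (f := fun i p => if i ∈ x p ↔ (p : ℕ) ∣ a i then (1 : ℝ) else 0),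
      h1]
    rw [← Finset.prod_univ_sum (fun p : P => W p)
      (fun p T => if dividingIndices a p = T then (1 : ℝ) else 0)]
    simp
  have hcount (n : ℕ) : (((box k n).filter fun a =>
        ∀ p ∈ P, dividingIndices a p ∈ W p).card : ℝ) / (n : ℝ) ^ k
      = ∑ x ∈ Fintype.piFinset fun p : P => W p, ∏ i, (∑ b ∈ Finset.Icc 1 n, ∏ p : P,
          if i ∈ x p ↔ (p : ℕ) ∣ b then (1 : ℝ) else 0) / n := by
    rw [← Finset.sum_boole, Finset.sum_congr rfl fun a _ => hind a, Finset.sum_comm,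
      Finset.sum_div]
    refine Finset.sum_congr rfl fun x _ => ?_
    rw [Finset.prod_div_distrib, Finset.prod_univ_sum]
    simp [box]
  rw [hlim]
  refine Tendsto.congr (fun n => (hcount n).symm) ?_
  refine tendsto_finsetSum _ fun x _ => tendsto_finsetProd _ fun i _ => ?_
  have h := tendsto_sum_dvd_pattern_div {p | ∃ h : p ∈ P, i ∈ x ⟨p, h⟩} P 1 (by simp)
  convert h using 2
  · congr 1
    refine Finset.sum_congr rfl fun b _ => ?_
    rw [← Finset.prod_coe_sort P]
    simp
  · rw [← Finset.prod_coe_sort P]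
    simp

end Sieve


/-! ### Local factors and convergence of the Euler product -/

section EulerFactor

variable {k : ℕ}

open Classical in
/-- The independent sets of `G` that avoid `S`. -/
noncomputable def indepSetsAvoiding (G : SimpleGraph (Fin k)) (S : Finset (Fin k)) :
    Finset (Finset (Fin k)) :=
  Finset.univ.filter fun T => G.IsIndepSet (T : Set (Fin k)) ∧ Disjoint T S

theorem mem_indepSetsAvoiding {G : SimpleGraph (Fin k)} {S T : Finset (Fin k)} :
    T ∈ indepSetsAvoiding G S ↔ G.IsIndepSet (T : Set (Fin k)) ∧ Disjoint T S := by
  simp [indepSetsAvoiding]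

theorem patternWeight_eq (p : ℕ) (T : Finset (Fin k)) :
    patternWeight p T = (1 - 1 / (p : ℝ)) ^ (k - T.card) * (1 / (p : ℝ) ^ T.card) := by
  rw [patternWeight, Finset.prod_ite, Finset.prod_const, Finset.prod_const, mul_comm]
  have h1 : Finset.univ.filter (fun i => i ∈ T) = T := by simp
  have h2 : Finset.univ.filter (fun i => i ∉ T) = Tᶜ := by ext; simp
  rw [h1, h2, Finset.card_compl, Fintype.card_fin, one_div_pow]

theorem patternWeight_nonneg {p : ℕ} (hp : 1 ≤ p) (T : Finset (Fin k)) :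
    0 ≤ patternWeight p T := by
  have : 1 / (p : ℝ) ≤ 1 := by
    rw [div_le_one (by positivity)]
    exact_mod_cast hp
  refine Finset.prod_nonneg fun i _ => ?_
  split_ifs
  · positivity
  · linarith

theorem patternWeight_le {p : ℕ} (hp : 1 ≤ p) {T : Finset (Fin k)} (hT : 2 ≤ T.card) :
    patternWeight p T ≤ 1 / (p : ℝ) ^ 2 := by
  have h1 : (1 : ℝ) ≤ p := by exact_mod_cast hp
  have h2 : 1 / (p : ℝ) ≤ 1 := by rwa [div_le_one (by positivity)]
  have h3 : 0 ≤ 1 / (p : ℝ) := by positivity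
  rw [patternWeight_eq]
  calc (1 - 1 / (p : ℝ)) ^ (k - T.card) * (1 / (p : ℝ) ^ T.card)
      ≤ 1 * (1 / (p : ℝ) ^ 2) := by
        gcongr
        exact pow_le_one₀ (by linarith) (by linarith)
    _ = _ := one_mul _

/-- Expand the product of `k` factors 1/p + (1 - 1/p). -/
theorem sum_patternWeight (p : ℕ) : ∑ T : Finset (Fin k), patternWeight p T = 1 := by
  have h := Fintype.prod_add (fun _ : Fin k => 1 / (p : ℝ)) (fun _ => 1 - 1 / (p : ℝ))
  simp only [add_sub_cancel, Finset.prod_const_one] at h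
  rw [h]
  refine Finset.sum_congr rfl fun T _ => ?_
  simp only [Finset.prod_const, Finset.card_compl, Fintype.card_fin, patternWeight_eq]
  rw [one_div_pow, mul_comm]

theorem sum_range_card_filter_mul (C : Finset (Fin k) → Prop) [DecidablePred C] (h : ℕ → ℝ) :
    ∑ m ∈ Finset.range (k + 1),
        (((Finset.univ.powersetCard m).filter C).card : ℝ) * h m
      = ∑ T ∈ Finset.univ.filter C, h T.card := by
  rw [← Finset.sum_fiberwise_of_maps_to (s := Finset.univ.filter C) (t := Finset.range (k + 1))
    (g := Finset.card)]
  · refine Finset.sum_congr rfl fun m _ => ?_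
    rw [Finset.sum_congr rfl (g := fun _ => h m) fun T hT => by rw [(Finset.mem_filter.1 hT).2],
      Finset.sum_const, nsmul_eq_mul]
    congr 3
    ext T
    simp [Finset.mem_powersetCard, and_comm]
  · intro T _
    have := Finset.card_le_univ T
    rw [Fintype.card_fin] at this
    simpa using Nat.lt_succ_of_le this

theorem eulerFactor_eq_sum_patternWeight (G : SimpleGraph (Fin k)) (p : ℕ) :
    eulerFactor G p = ∑ T ∈ indepSetsAvoiding G ∅, patternWeight p T := by
  classical
  simp only [eulerFactor, indepCount, mul_assoc]
  rw [sum_range_card_filter_mul _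
    (fun m => (1 - 1 / (p : ℝ)) ^ (k - m) * (1 / (p : ℝ) ^ m))]
  simp only [patternWeight_eq]
  refine Finset.sum_congr ?_ fun _ _ => rfl
  ext T
  simp [mem_indepSetsAvoiding]

theorem sub_one_pow_eq_mul_patternWeight {p : ℕ} (hp : 1 ≤ p) (T : Finset (Fin k)) :
    ((p : ℝ) - 1) ^ (k - T.card) = (p : ℝ) ^ k * patternWeight p T := by
  have hp0 : (p : ℝ) ≠ 0 := by positivity
  have hT : T.card ≤ k := by simpa using Finset.card_le_univ T
  have h1 : (1 - 1 / (p : ℝ)) = ((p : ℝ) - 1) / p := by field_simp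
  have h2 : (p : ℝ) ^ k = (p : ℝ) ^ (k - T.card) * (p : ℝ) ^ T.card := by
    rw [← pow_add, Nat.sub_add_cancel hT]
  rw [patternWeight_eq, h1, div_pow, h2]
  field_simp

/-- The factor of `f_G(u)` at `p`, as a function of `S = S(u,p)`. -/
noncomputable def correctionFactor (G : SimpleGraph (Fin k)) (S : Finset (Fin k)) (p : ℕ) : ℝ :=
  1 - (∑ m ∈ Finset.range (k + 1), (indepCountMeeting G S m : ℝ) * ((p : ℝ) - 1) ^ (k - m)) /
    (∑ m ∈ Finset.range (k + 1), (indepCount G m : ℝ) * ((p : ℝ) - 1) ^ (k - m))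

/-- The empty set is independent and has weight (1 - 1/p)^k > 0. Positivity makes the division in
`correctionFactor` legitimate. -/
theorem eulerFactor_pos (G : SimpleGraph (Fin k)) {p : ℕ} (hp : 2 ≤ p) : 0 < eulerFactor G p := by
  have h1 : 1 / (p : ℝ) < 1 := by
    rw [div_lt_one (by positivity)]
    exact_mod_cast hp
  rw [eulerFactor_eq_sum_patternWeight]
  refine Finset.sum_pos' (fun T _ => patternWeight_nonneg (by omega) T)
    ⟨∅, by simp [mem_indepSetsAvoiding, SimpleGraph.IsIndepSet], ?_⟩
  rw [patternWeight_eq]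
  simpa using pow_pos (show 0 < 1 - (p : ℝ)⁻¹ by rw [← one_div]; linarith) k

/-- After cancelling p^k, the quotient in `correctionFactor` is the conditional probability that a
random independent set meets `S`. -/
theorem sum_indepSetsAvoiding_patternWeight (G : SimpleGraph (Fin k)) (S : Finset (Fin k))
    {p : ℕ} (hp : 2 ≤ p) :
    ∑ T ∈ indepSetsAvoiding G S, patternWeight p T = eulerFactor G p * correctionFactor G S p := by
  classical
  have hpk : (p : ℝ) ^ k ≠ 0 := by positivity
  have he := (eulerFactor_pos G hp).ne'
  have hden : ∑ m ∈ Finset.range (k + 1), (indepCount G m : ℝ) * ((p : ℝ) - 1) ^ (k - m)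
      = (p : ℝ) ^ k * eulerFactor G p := by
    rw [eulerFactor_eq_sum_patternWeight, Finset.mul_sum]
    simp only [indepCount]
    rw [sum_range_card_filter_mul _ (fun m => ((p : ℝ) - 1) ^ (k - m))]
    refine Finset.sum_congr ?_ fun T _ => sub_one_pow_eq_mul_patternWeight (by omega) T
    ext T
    simp [mem_indepSetsAvoiding]
  have hnum : ∑ m ∈ Finset.range (k + 1),
        (indepCountMeeting G S m : ℝ) * ((p : ℝ) - 1) ^ (k - m)
      = (p : ℝ) ^ k *
        (eulerFactor G p - ∑ T ∈ indepSetsAvoiding G S, patternWeight p T) := by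
    have hsub : indepSetsAvoiding G S ⊆ indepSetsAvoiding G ∅ := fun T hT => by
      rw [mem_indepSetsAvoiding] at hT ⊢
      exact ⟨hT.1, Finset.disjoint_empty_right _⟩
    rw [eulerFactor_eq_sum_patternWeight, ← Finset.sum_sdiff_eq_sub hsub, Finset.mul_sum]
    simp only [indepCountMeeting]
    rw [sum_range_card_filter_mul _ (fun m => ((p : ℝ) - 1) ^ (k - m))]
    refine Finset.sum_congr ?_ fun T _ => sub_one_pow_eq_mul_patternWeight (by omega) T
    ext T
    simp only [Finset.mem_filter_univ, Finset.mem_sdiff, mem_indepSetsAvoiding,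
      Finset.disjoint_empty_right, and_true, Finset.not_disjoint_iff, not_and]
    exact ⟨fun h => ⟨h.1, fun _ => h.2⟩, fun h => ⟨h.1, h.2 h.1⟩⟩
  rw [correctionFactor, hden, hnum]
  field_simp
  ring

theorem correctionFactor_empty (G : SimpleGraph (Fin k)) (p : ℕ) :
    correctionFactor G ∅ p = 1 := by
  simp [correctionFactor, indepCountMeeting]

/-- All weights sum to 1, and sets with at most one vertex are independent. Only sets of size at
least 2 are missing: at most 2^k of them, each of weight at most 1/p². -/
theorem abs_eulerFactor_sub_one_le (G : SimpleGraph (Fin k)) {p : ℕ} (hp : 1 ≤ p) :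
    |eulerFactor G p - 1| ≤ 2 ^ k * (1 / (p : ℝ) ^ 2) := by
  classical
  have h1 : eulerFactor G p - 1
      = -∑ T ∈ Finset.univ \ indepSetsAvoiding G ∅, patternWeight p T := by
    rw [Finset.sum_sdiff_eq_sub (Finset.subset_univ _), sum_patternWeight,
      eulerFactor_eq_sum_patternWeight]
    ring
  rw [h1, abs_neg, abs_of_nonneg (Finset.sum_nonneg fun T _ => patternWeight_nonneg hp T)]
  calc ∑ T ∈ Finset.univ \ indepSetsAvoiding G ∅, patternWeight p T
      ≤ ∑ T ∈ Finset.univ \ indepSetsAvoiding G ∅, 1 / (p : ℝ) ^ 2 := by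
        refine Finset.sum_le_sum fun T hT => patternWeight_le hp ?_
        by_contra hlt
        rw [Finset.mem_sdiff, mem_indepSetsAvoiding] at hT
        refine hT.2 ⟨?_, Finset.disjoint_empty_right _⟩
        exact Set.Subsingleton.pairwise
          (Finset.card_le_one_iff_subsingleton.1 (by omega)) _
    _ ≤ ∑ T : Finset (Fin k), 1 / (p : ℝ) ^ 2 :=
        Finset.sum_le_sum_of_subset_of_nonneg (Finset.subset_univ _) fun _ _ _ => by positivity
    _ = 2 ^ k * (1 / (p : ℝ) ^ 2) := by simp

theorem summable_one_div_primes_sq : Summable fun p : Nat.Primes => 1 / ((p : ℕ) : ℝ) ^ 2 :=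
  (Real.summable_one_div_nat_pow.2 one_lt_two).comp_injective Subtype.val_injective

theorem hasProd_eulerFactor (G : SimpleGraph (Fin k)) :
    HasProd (fun p : Nat.Primes => eulerFactor G p) (A G) := by
  have h : Summable fun p : Nat.Primes => ‖eulerFactor G p - 1‖ :=
    (summable_one_div_primes_sq.mul_left (2 ^ k)).of_nonneg_of_le (fun _ => norm_nonneg _)
      fun p => abs_eulerFactor_sub_one_le G p.2.one_le
  have hm := multipliable_one_add_of_summable h
  simp only [add_sub_cancel] at hm
  exact hm.hasProd

/-- Primes of `P` dividing no `u i` have S(u,p) empty and contribute 1. -/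
theorem prod_correctionFactor_eq_f (G : SimpleGraph (Fin k)) {u : Fin k → ℕ} (hu : ∀ i, 0 < u i)
    {P : Finset Nat.Primes} (hP : ∀ p : Nat.Primes, ∀ i, (p : ℕ) ∣ u i → p ∈ P) :
    ∏ p ∈ P, correctionFactor G (dividingIndices u p) p = f G u := by
  classical
  have hf : f G u = ∏ p ∈ (∏ i, u i).primeFactors, correctionFactor G (dividingIndices u p) p := rfl
  have hmap : ∏ p ∈ P, correctionFactor G (dividingIndices u p) p
      = ∏ p ∈ P.map ⟨Subtype.val, Subtype.val_injective⟩,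
        correctionFactor G (dividingIndices u p) p :=
    (Finset.prod_map P ⟨Subtype.val, Subtype.val_injective⟩
      fun p => correctionFactor G (dividingIndices u p) p).symm
  rw [hf, hmap]
  symm
  refine Finset.prod_subset (fun p hp => ?_) fun p hp hp' => ?_
  · have hpp := Nat.prime_of_mem_primeFactors hp
    obtain ⟨i, -, hi⟩ := (hpp.prime.dvd_finsetProd_iff _).1 (Nat.dvd_of_mem_primeFactors hp)
    exact Finset.mem_map.2 ⟨⟨p, hpp⟩, hP ⟨p, hpp⟩ i hi, rfl⟩
  · obtain ⟨q, -, rfl⟩ := Finset.mem_map.1 hp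
    have : dividingIndices u q = ∅ := by
      refine Finset.filter_eq_empty_iff.2 fun i _ hi => hp' ?_
      exact Nat.mem_primeFactors.2 ⟨q.2, hi.trans (Finset.dvd_prod_of_mem _ (Finset.mem_univ i)),
        Finset.prod_ne_zero_iff.2 fun i _ => (hu i).ne'⟩
    exact (congrArg (fun S => correctionFactor G S q) this).trans (correctionFactor_empty G q)

end EulerFactor

/-! ### Uniform bound for the large primes -/

section Tail

variable {k : ℕ}

theorem dividingIndices_mem_indepSetsAvoiding_iff {G : SimpleGraph (Fin k)} {a u : Fin k → ℕ}
    {p : ℕ} : dividingIndices a p ∈ indepSetsAvoiding G (dividingIndices u p) ↔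
      (∀ i j, G.Adj i j → ¬(p ∣ a i ∧ p ∣ a j)) ∧ ∀ i, ¬(p ∣ a i ∧ p ∣ u i) := by
  rw [mem_indepSetsAvoiding, Finset.disjoint_left]
  refine and_congr ⟨fun h i j hij hp => ?_, fun h i hi j hj _ hij => ?_⟩ ?_
  · exact h (by simp [dividingIndices, hp.1]) (by simp [dividingIndices, hp.2]) hij.ne hij
  · simp only [dividingIndices, Finset.coe_filter, Finset.mem_univ, true_and,
      Set.mem_ofPred_eq] at hi hj
    exact h i j hij ⟨hi, hj⟩
  · simp [dividingIndices]

theorem coprime_iff_forall_primes {m n : ℕ} :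
    Nat.Coprime m n ↔ ∀ p : Nat.Primes, ¬((p : ℕ) ∣ m ∧ (p : ℕ) ∣ n) := by
  rw [← not_iff_not, Nat.Prime.not_coprime_iff_dvd]
  simp [Nat.Primes]

theorem coprime_and_gwiseCoprime_iff {G : SimpleGraph (Fin k)} {a u : Fin k → ℕ} :
    ((∀ i, Nat.Coprime (a i) (u i)) ∧ GwiseCoprime G a) ↔
      ∀ p : Nat.Primes, dividingIndices a p ∈ indepSetsAvoiding G (dividingIndices u p) := by
  simp only [dividingIndices_mem_indepSetsAvoiding_iff, GwiseCoprime, coprime_iff_forall_primes]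
  exact ⟨fun h p => ⟨fun i j hij => h.2 i j hij p, fun i => h.1 i p⟩,
    fun h => ⟨fun i p => (h p).2 i, fun i j hij p => (h p).1 i j hij⟩⟩

/-- Each of the two coordinates has ⌊n/d⌋ ≤ n/d choices, so there is no error term and the bound can
be summed over primes uniformly in `n`. -/
theorem card_filter_dvd_dvd_div_le {i j : Fin k} (hij : i ≠ j) (d : ℕ) {n : ℕ} (hn : 0 < n) :
    (((box k n).filter fun a => d ∣ a i ∧ d ∣ a j).card : ℝ) / (n : ℝ) ^ k
      ≤ 1 / (d : ℝ) ^ 2 := by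
  classical
  have hset : (box k n).filter (fun a => d ∣ a i ∧ d ∣ a j)
      = Fintype.piFinset fun l => if l ∈ ({i, j} : Finset (Fin k))
          then (Finset.Icc 1 n).filter (d ∣ ·) else Finset.Icc 1 n := by
    ext a
    simp only [box, Finset.mem_filter, Fintype.mem_piFinset]
    constructor
    · rintro ⟨h, hi, hj⟩ l
      split_ifs with hl
      · rw [Finset.mem_insert, Finset.mem_singleton] at hl
        rcases hl with rfl | rfl
        exacts [Finset.mem_filter.2 ⟨h _, hi⟩, Finset.mem_filter.2 ⟨h _, hj⟩]
      · exact h l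
    · intro h
      refine ⟨fun l => ?_, ?_, ?_⟩
      · have := h l
        split_ifs at this
        exacts [(Finset.mem_filter.1 this).1, this]
      · have := h i
        rw [if_pos (by simp)] at this
        exact (Finset.mem_filter.1 this).2
      · have := h j
        rw [if_pos (by simp)] at this
        exact (Finset.mem_filter.1 this).2
  have hn' : (0 : ℝ) < n := by exact_mod_cast hn
  have hpow : (n : ℝ) ^ k = ∏ _l : Fin k, (n : ℝ) := by simp
  rw [hset, Fintype.card_piFinset, hpow, Nat.cast_prod, ← Finset.prod_div_distrib]
  calc _ ≤ ∏ l : Fin k, if l ∈ ({i, j} : Finset (Fin k)) then 1 / (d : ℝ) else 1 := by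
        refine Finset.prod_le_prod (fun _ _ => by positivity) fun l _ => ?_
        split_ifs
        · have hc : ((Finset.Icc 1 n).filter (d ∣ ·)).card = n / d :=
            Nat.Ioc_filter_dvd_card_eq_div n d
          rw [hc, div_le_iff₀ hn']
          calc ((n / d : ℕ) : ℝ) ≤ (n : ℝ) / d := Nat.cast_div_le
            _ = 1 / d * n := by ring
        · rw [Nat.card_Icc, Nat.add_sub_cancel, div_self hn'.ne']
    _ = 1 / (d : ℝ) ^ 2 := by
        rw [Finset.prod_ite_mem, Finset.univ_inter, Finset.prod_const, Finset.card_pair hij,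
          one_div_pow]

open Classical in
/-- Sieving by a finite set `P` of primes containing all the prime factors of the `u i` already
gives `Q` up to a relative error bounded by a tail of `∑ 1 / p ^ 2`. -/
theorem abs_Q_div_sub_card_div_le (G : SimpleGraph (Fin k)) {u : Fin k → ℕ}
    {P : Finset Nat.Primes} (hP : ∀ p : Nat.Primes, ∀ i, (p : ℕ) ∣ u i → p ∈ P)
    {n : ℕ} (hn : 0 < n) :
    |(Q G u n : ℝ) / (n : ℝ) ^ k - (((box k n).filter fun a =>
        ∀ p ∈ P, dividingIndices a p ∈ indepSetsAvoiding G (dividingIndices u p)).card : ℝ) /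
          (n : ℝ) ^ k|
      ≤ k ^ 2 * (∑' p : Nat.Primes, 1 / ((p : ℕ) : ℝ) ^ 2 - ∑ p ∈ P, 1 / ((p : ℕ) : ℝ) ^ 2) := by
  set B := (box k n).filter fun a =>
    ∀ p ∈ P, dividingIndices a p ∈ indepSetsAvoiding G (dividingIndices u p) with hB
  set C := (box k n).filter fun a => (∀ i, Nat.Coprime (a i) (u i)) ∧ GwiseCoprime G a with hC
  have hQ : Q G u n = C.card := rfl
  have hCB : C ⊆ B := fun a ha => by
    rw [hC, Finset.mem_filter, coprime_and_gwiseCoprime_iff] at ha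
    exact Finset.mem_filter.2 ⟨ha.1, fun p _ => ha.2 p⟩
  -- A prime above `n` divides no entry of the box, so the union bound is finite.
  set R : Finset Nat.Primes := (Finset.range (n + 1)).subtype Nat.Prime with hR
  set E := (Finset.univ : Finset (Fin k × Fin k)).filter fun x => G.Adj x.1 x.2 with hE
  have hcover : B \ C ⊆ (E ×ˢ (R \ P)).biUnion fun x =>
      (box k n).filter fun a => (x.2 : ℕ) ∣ a x.1.1 ∧ (x.2 : ℕ) ∣ a x.1.2 := by
    intro a ha
    rw [Finset.mem_sdiff, hB, hC, Finset.mem_filter, Finset.mem_filter,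
      coprime_and_gwiseCoprime_iff] at ha
    obtain ⟨⟨ha, hgood⟩, hbad⟩ := ha
    have hbad' : ∃ p : Nat.Primes,
        dividingIndices a p ∉ indepSetsAvoiding G (dividingIndices u p) := by
      by_contra h
      push Not at h
      exact hbad ⟨ha, h⟩
    obtain ⟨p, hp⟩ := hbad'
    have hpP : p ∉ P := fun h => hp (hgood p h)
    rw [dividingIndices_mem_indepSetsAvoiding_iff] at hp
    -- Failure through a common factor with `u i` would put `p` in `P`.
    have hadj : ∃ i j, G.Adj i j ∧ (p : ℕ) ∣ a i ∧ (p : ℕ) ∣ a j := by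
      by_contra h
      push Not at h
      exact hp ⟨fun i j hij h' => h i j hij h'.1 h'.2, fun i h' => hpP (hP p i h'.2)⟩
    obtain ⟨i, j, hij, hi, hj⟩ := hadj
    have hai := Finset.mem_Icc.1 (Fintype.mem_piFinset.1 ha i)
    have hpn : (p : ℕ) ≤ n := (Nat.le_of_dvd hai.1 hi).trans hai.2
    refine Finset.mem_biUnion.2 ⟨((i, j), p), Finset.mem_product.2 ⟨?_, ?_⟩, ?_⟩
    · simpa [hE] using hij
    · refine Finset.mem_sdiff.2 ⟨?_, hpP⟩
      exact Finset.mem_subtype.2 (Finset.mem_range.2 (Nat.lt_succ_of_le hpn))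
    · exact Finset.mem_filter.2 ⟨ha, hi, hj⟩
  have hcard : ((B \ C).card : ℝ) = B.card - C.card := by
    rw [Finset.card_sdiff_of_subset hCB, Nat.cast_sub (Finset.card_le_card hCB)]
  have habs : |(Q G u n : ℝ) / (n : ℝ) ^ k - (B.card : ℝ) / (n : ℝ) ^ k|
      = ((B \ C).card : ℝ) / (n : ℝ) ^ k := by
    rw [hQ, abs_sub_comm, ← sub_div, ← hcard, abs_of_nonneg (by positivity)]
  have hEk : (E.card : ℝ) ≤ (k : ℝ) ^ 2 := by
    have : E.card ≤ k ^ 2 := (Finset.card_le_univ E).trans (by simp [sq])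
    exact_mod_cast this
  have htail : ∑ p ∈ R \ P, 1 / ((p : ℕ) : ℝ) ^ 2
      ≤ ∑' p : Nat.Primes, 1 / ((p : ℕ) : ℝ) ^ 2 - ∑ p ∈ P, 1 / ((p : ℕ) : ℝ) ^ 2 := by
    rw [le_sub_iff_add_le, ← Finset.sum_union Finset.sdiff_disjoint]
    exact summable_one_div_primes_sq.sum_le_tsum _ fun _ _ => by positivity
  rw [habs]
  calc ((B \ C).card : ℝ) / (n : ℝ) ^ k
      ≤ (∑ x ∈ E ×ˢ (R \ P), (((box k n).filter fun a =>
          (x.2 : ℕ) ∣ a x.1.1 ∧ (x.2 : ℕ) ∣ a x.1.2).card : ℝ)) / (n : ℝ) ^ k := by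
        gcongr
        exact_mod_cast (Finset.card_le_card hcover).trans Finset.card_biUnion_le
    _ ≤ ∑ x ∈ E ×ˢ (R \ P), 1 / ((x.2 : ℕ) : ℝ) ^ 2 := by
        rw [Finset.sum_div]
        refine Finset.sum_le_sum fun x hx => ?_
        have hadj : G.Adj x.1.1 x.1.2 := (Finset.mem_filter.1 (Finset.mem_product.1 hx).1).2
        exact card_filter_dvd_dvd_div_le hadj.ne x.2 hn
    _ = E.card * ∑ p ∈ R \ P, 1 / ((p : ℕ) : ℝ) ^ 2 := by
        have h := Finset.sum_product E (R \ P) fun x => 1 / ((x.2 : ℕ) : ℝ) ^ 2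
        simp only [Finset.sum_const, nsmul_eq_mul] at h
        exact h
    _ ≤ _ := by
        gcongr

end Tail

/-! ### Interchange of limits and the densities -/

section Limit

/-- A uniform limit of convergent sequences converges to the limit of the limits. -/
theorem tendsto_of_abs_sub_le {ι : Type*} {l : Filter ι} [l.NeBot] {F : ℕ → ℝ} {g : ι → ℕ → ℝ}
    {L t : ι → ℝ} {M : ℝ} (hg : ∀ i, Tendsto (g i) atTop (𝓝 (L i))) (hL : Tendsto L l (𝓝 M))
    (ht : Tendsto t l (𝓝 0)) (hF : ∀ᶠ i in l, ∀ᶠ n in atTop, |F n - g i n| ≤ t i) :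
    Tendsto F atTop (𝓝 M) := by
  rw [Metric.tendsto_atTop']
  intro ε hε
  have h1 := Metric.tendsto_nhds.1 hL (ε / 3) (by positivity)
  have h2 := Metric.tendsto_nhds.1 ht (ε / 3) (by positivity)
  obtain ⟨i, h1, h2, h3⟩ := (h1.and (h2.and hF)).exists
  have h4 := Metric.tendsto_nhds.1 (hg i) (ε / 3) (by positivity)
  obtain ⟨N, hN⟩ := eventually_atTop.1 (h3.and h4)
  refine ⟨N, fun n hn => ?_⟩
  obtain ⟨h5, h6⟩ := hN n hn.le
  rw [Real.dist_eq] at *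
  rw [abs_lt] at *
  rw [abs_le] at h5
  constructor <;> linarith [h1.1, h1.2, h2.1, h2.2, h5.1, h5.2, h6.1, h6.2]

theorem tendsto_Q_div {k : ℕ} (G : SimpleGraph (Fin k)) {u : Fin k → ℕ} (hu : ∀ i, 0 < u i) :
    Tendsto (fun n : ℕ => (Q G u n : ℝ) / (n : ℝ) ^ k) atTop (𝓝 (A G * f G u)) := by
  classical
  obtain ⟨P₀, hP₀⟩ : ∃ P₀ : Finset Nat.Primes,
      ∀ p : Nat.Primes, ∀ i, (p : ℕ) ∣ u i → p ∈ P₀ := by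
    refine ⟨(∏ i, u i).primeFactors.subtype Nat.Prime, fun p i hi => ?_⟩
    exact Finset.mem_subtype.2 (Nat.mem_primeFactors.2 ⟨p.2,
      hi.trans (Finset.dvd_prod_of_mem _ (Finset.mem_univ i)),
      Finset.prod_ne_zero_iff.2 fun i _ => (hu i).ne'⟩)
  have hmem : ∀ᶠ P in atTop, ∀ p : Nat.Primes, ∀ i, (p : ℕ) ∣ u i → p ∈ P :=
    (eventually_ge_atTop P₀).mono fun P hP p i hi => hP (hP₀ p i hi)
  -- The limit runs over finite sets of primes ordered by inclusion, matching unconditional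
  -- convergence of the product.
  refine tendsto_of_abs_sub_le (l := (atTop : Filter (Finset Nat.Primes)))
    (t := fun P => (k : ℝ) ^ 2 *
      (∑' p : Nat.Primes, 1 / ((p : ℕ) : ℝ) ^ 2 - ∑ p ∈ P, 1 / ((p : ℕ) : ℝ) ^ 2))
    (fun P => tendsto_card_dividingIndices_mem_div P
      fun p => indepSetsAvoiding G (dividingIndices u p)) ?_ ?_ ?_
  -- Once `P` contains the primes dividing the `u i`, the sieve density is exactly the partial Euler
  -- product times `f G u`.
  · refine Tendsto.congr' ?_ (Tendsto.mul_const (f G u) (hasProd_eulerFactor G))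
    filter_upwards [hmem] with P hP
    rw [← prod_correctionFactor_eq_f G hu hP, ← Finset.prod_mul_distrib]
    exact Finset.prod_congr rfl fun p _ =>
      (sum_indepSetsAvoiding_patternWeight G _ p.2.two_le).symm
  · have h : Tendsto (fun P : Finset Nat.Primes => ∑ p ∈ P, 1 / ((p : ℕ) : ℝ) ^ 2) atTop
        (𝓝 (∑' p : Nat.Primes, 1 / ((p : ℕ) : ℝ) ^ 2)) := summable_one_div_primes_sq.hasSum
    have h' := (h.const_sub (∑' p : Nat.Primes, 1 / ((p : ℕ) : ℝ) ^ 2)).const_mul ((k : ℝ) ^ 2)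
    rwa [sub_self, mul_zero] at h'
  · filter_upwards [hmem] with P hP
    filter_upwards [eventually_gt_atTop 0] with n hn
    exact abs_Q_div_sub_card_div_le G hP hn

theorem hasDensity_gwiseCoprime_and_coprime {k : ℕ} (G : SimpleGraph (Fin k)) {u : Fin k → ℕ}
    (hu : ∀ i, 0 < u i) :
    HasDensity {a : Fin k → ℕ | GwiseCoprime G a ∧ ∀ i, Nat.Coprime (a i) (u i)}
      (A G * f G u) := by
  classical
  refine (tendsto_Q_div G hu).congr fun n => ?_
  rw [Q]
  congr 3
  ext a
  simp only [Finset.mem_filter, Set.mem_ofPred_eq, and_comm]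

theorem hasDensity_gwiseCoprime {k : ℕ} (G : SimpleGraph (Fin k)) :
    HasDensity {a : Fin k → ℕ | GwiseCoprime G a} (A G) := by
  have h := hasDensity_gwiseCoprime_and_coprime G (u := fun _ => 1) fun _ => one_pos
  -- No prime divides 1, so the product defining `f` is empty.
  simpa [f] using h

end Limit

end GwisePrimality

theorem corollary2 (k : ℕ) (G : SimpleGraph (Fin k)) :
    -- the Euler product converges (unconditionally), with value `A G`
    HasProd (fun p : Nat.Primes => ∑ m ∈ Finset.range (k + 1),
        (GwisePrimality.indepCount G m : ℝ) * (1 - 1 / ((p : ℕ) : ℝ)) ^ (k - m) *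
          (1 / ((p : ℕ) : ℝ) ^ m))
      (GwisePrimality.A G) ∧
    -- the density for arbitrary positive `u`
    (∀ u : Fin k → ℕ, (∀ i, 0 < u i) →
      Tendsto (fun n : ℕ => (GwisePrimality.Q G u n : ℝ) / (n : ℝ) ^ k) atTop
        (𝓝 (GwisePrimality.A G * GwisePrimality.f G u)) ∧
      GwisePrimality.HasDensity
        {a : Fin k → ℕ | GwisePrimality.GwiseCoprime G a ∧ ∀ i, Nat.Coprime (a i) (u i)}
        (GwisePrimality.A G * GwisePrimality.f G u)) ∧
    -- the case in which all `u i` equal `1`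
    GwisePrimality.HasDensity {a : Fin k → ℕ | GwisePrimality.GwiseCoprime G a}
      (GwisePrimality.A G) := by
  exact ⟨GwisePrimality.hasProd_eulerFactor G, fun u hu => ⟨GwisePrimality.tendsto_Q_div G hu,
    GwisePrimality.hasDensity_gwiseCoprime_and_coprime G hu⟩,
    GwisePrimality.hasDensity_gwiseCoprime G⟩
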